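/- **Setting.** A randomized trial deploys finitely many deterministic policies. The variables are generated by $D=f_D(\epsilon_D)$ (cluster), $X=f_X(\epsilon_X)\in\mathcal X$ (covariates), $\Pi=\pi_D\in\varPi$ (deployed policy, a function $\mathcal X\to\mathcal A$), $M=f_M(\Pi)\in\mathbb R$ (performance; $f_M$ is defined for every policy), $A=\Pi(X)$, $Y=f_Y(A,X,M,\epsilon_Y)\in\mathbb R$, with $\epsilon_D,\epsilon_X,\epsilon_Y$ mutually independent. Here $\varPi$ is the finite set of trialed policies, each assigned with positive probability. Assume $Y_{\min}\le Y\le Y_{\max}$ almost surely. Write $Y(a,m)=f_Y(a,X,m,\epsilon_Y)$. Fix an action $a_0\in\mathcal A$ and a new policy $\pi_e:\mathcal X\to\mathcal A$. For $x\in\mathcal X$ let $\mathbf\Pi^e(x)=\{\pi\in\varPi:\pi(x)=\pi_e(x)\}$, let $\tilde{\mathbf\Pi}^e_{\le}(x)$ be the set of maximizers of $f_M$ over $\{\pi\in\mathbf\Pi^e(x): f_M(\pi)\le f_M(\pi_e)\}$, and let $\tilde{\mathbf\Pi}^e_{\ge}(x)$ be the set of minimizers of $f_M$ over $\{\pi\in\mathbf\Pi^e(x):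 f_M(\pi)\ge f_M(\pi_e)\}$ (empty if that set is empty). Define $$L(\pi_e)=\mathbb E\big[\mathbf 1\{\pi_e(X)\ne a_0\}\big(\mathbf 1\{\tilde{\mathbf\Pi}^e_{\le}(X)\ne\varnothing\}\,\mathbb E[Y\mid X,\Pi\in\tilde{\mathbf\Pi}^e_{\le}(X)]+\mathbf 1\{\tilde{\mathbf\Pi}^e_{\le}(X)=\varnothing\}Y_{\min}\big)+\mathbf 1\{\pi_e(X)=a_0\}\big(\mathbf 1\{\mathbf\Pi^e(X)\ne\varnothing\}\,\mathbb E[Y\mid X,\Pi\in\mathbf\Pi^e(X)]+\mathbf 1\{\mathbf\Pi^e(X)=\varnothing\}Y_{\min}\big)\big],$$ and $U(\pi_e)$ by the same formula with $\tilde{\mathbf\Pi}^e_{\ge}$ for $\tilde{\mathbf\Pi}^e_{\le}$ and $Y_{\max}$ for $Y_{\min}$. Define $$\psi_L(Y,X,\Pi)=\begin{cases}Y\,\dfrac{\mathbf 1\{\Pi\in\tilde{\mathbf\Pi}^e_{\le}(X)\}}{P(\Pi\in\tilde{\mathbf\Pi}^e_{\le}(X))},&\tilde{\mathbf\Pi}^e_{\le}(X)\ne\varnothing,\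 \pi_e(X)\ne a_0,\\ Y_{\min},&\tilde{\mathbf\Pi}^e_{\le}(X)=\varnothing,\ \pi_e(X)\ne a_0,\\ Y\,\dfrac{\mathbf 1\{\Pi\in\mathbf\Pi^e(X)\}}{P(\Pi\in\mathbf\Pi^e(X))},&\mathbf\Pi^e(X)\ne\varnothing,\ \pi_e(X)=a_0,\\ Y_{\min},&\mathbf\Pi^e(X)=\varnothing,\ \pi_e(X)=a_0,\end{cases}$$ and $\psi_U$ likewise with $\tilde{\mathbf\Pi}^e_{\ge}$ and $Y_{\max}$; here $P(\Pi\in T(X))$ means $P(\Pi\in T(x))$ evaluated at $x=X$. Let the data $(Y_i,X_i,D_i)$, with $\Pi_i=\pi_{D_i}$, be i.i.d. copies of $(Y,X,D)$, and put $\hat L_n=n^{-1}\sum_{i}\psi_L(Y_i,X_i,\Pi_i)$, $\hat U_n=n^{-1}\sum_{i}\psi_U(Y_i,X_i,\Pi_i)$ (sums over the first $n$ observations); let $\hat\sigma_{L},\hat\sigma_U$ be the empirical standard deviations of the values of $\psi_L,\psi_U$ in this sample, and let $\Phi$ be the standard normal distribution function. **Claim.** 1. $L(\pi_e)=\mathbb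 E[\psi_L(Y,X,\Pi)]$ and $U(\pi_e)=\mathbb E[\psi_U(Y,X,\Pi)]$. All these expectations exist, and $\psi_L,\psi_U$ are square-integrable. 2. As $n\to\infty$, $\sqrt n\,(L(\pi_e)-\hat L_n)\to N(0,\operatorname{Var}\psi_L)$ and $\sqrt n\,(U(\pi_e)-\hat U_n)\to N(0,\operatorname{Var}\psi_U)$ in distribution. 3. For every $\alpha\in(0,1)$, with $z=\Phi^{-1}(1-\alpha/2)$, the interval $I_n=\big[\hat L_n-z\hat\sigma_L/\sqrt n,\ \hat U_n+z\hat\sigma_U/\sqrt n\big]$ is an asymptotically valid $(1-\alpha)$-confidence interval: $$\liminf_{n\to\infty}P\big(\hat L_n-z\hat\sigma_L/\sqrt n\le L(\pi_e)\ \text{ and }\ U(\pi_e)\le\hat U_n+z\hat\sigma_U/\sqrt n\big)\ge 1-\alpha .$$ If moreover, almost surely, $Y(a,m)\le Y(a,m')$ for all $a$ and all $m<m'$, $Y(a_0,m)$ does not depend on $m$, and $Y_{\min}\le Y(a,m)\le Y_{\max}$ for all $a,m$, then also $\liminf_{n}P\big(\mathbb E[Y(\pi_e(X),f_M(\pi_e))]\in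 I_n\big)\ge 1-\alpha$, i.e. $I_n$ is asymptotically valid for the policy value. -/

import Mathlib

open MeasureTheory ProbabilityTheory Filter

/-- A randomized trial of finitely many deterministic policies `𝒳 → 𝒜`, as a structural causal
model: `D = fD εD`, `X = fX εX`, `Π = pol D`, `M = fM Π`, `A = Π X`, `Y = fY A X M εY`, where the
exogenous noises `εD`, `εX`, `εY` have laws `νD`, `νX`, `νY` (their joint law is the product
measure `TrialSCM.law`, i.e. they are mutually independent). -/
structure TrialSCM (ED EX EY 𝒟 𝒳 𝒜 : Type*) [MeasurableSpace ED] [MeasurableSpace EX]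
    [MeasurableSpace EY] [MeasurableSpace 𝒟] [MeasurableSpace 𝒳] [MeasurableSpace 𝒜] where
  /-- law of the noise of the cluster assignment -/
  νD : Measure ED
  /-- law of the noise of the covariates -/
  νX : Measure EX
  /-- law of the noise of the outcome -/
  νY : Measure EY
  isProbabilityMeasure_νD : IsProbabilityMeasure νD
  isProbabilityMeasure_νX : IsProbabilityMeasure νX
  isProbabilityMeasure_νY : IsProbabilityMeasure νY
  /-- structural equation of the cluster -/
  fD : ED → 𝒟
  /-- structural equation of the covariates -/
  fX : EX → 𝒳
  /-- the policy `π_d` deployed in cluster `d` -/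
  pol : 𝒟 → 𝒳 → 𝒜
  /-- the performance functional, defined for every policy -/
  fM : (𝒳 → 𝒜) → ℝ
  /-- structural equation of the outcome -/
  fY : 𝒜 → 𝒳 → ℝ → EY → ℝ
  measurable_fD : Measurable fD
  measurable_fX : Measurable fX
  measurable_pol : ∀ d, Measurable (pol d)
  measurable_fY : Measurable fun p : 𝒜 × 𝒳 × ℝ × EY => fY p.1 p.2.1 p.2.2.1 p.2.2.2
  /-- the trial has finitely many arms -/
  finite_range_pol : (Set.range pol).Finite
  measurableSet_arm : ∀ π : 𝒳 → 𝒜, MeasurableSet {d | pol d = π}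

noncomputable section

namespace TrialSCM

variable {ED EX EY 𝒟 𝒳 𝒜 : Type*} [MeasurableSpace ED] [MeasurableSpace EX]
  [MeasurableSpace EY] [MeasurableSpace 𝒟] [MeasurableSpace 𝒳] [MeasurableSpace 𝒜]
  (S : TrialSCM ED EX EY 𝒟 𝒳 𝒜)

/-! ### The random variables of the model, on the space of noises -/

/-- Joint law of the mutually independent noises. -/
def law : Measure (ED × EX × EY) := S.νD.prod (S.νX.prod S.νY)

instance : IsProbabilityMeasure S.law := by
  have := S.isProbabilityMeasure_νD
  have := S.isProbabilityMeasure_νX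
  have := S.isProbabilityMeasure_νY
  unfold law
  infer_instance

/-- The cluster. -/
def D (ε : ED × EX × EY) : 𝒟 := S.fD ε.1

/-- The covariates. -/
def X (ε : ED × EX × EY) : 𝒳 := S.fX ε.2.1

/-- The deployed policy `Π = π_D`. -/
def Pi (ε : ED × EX × EY) : 𝒳 → 𝒜 := S.pol (S.D ε)

/-- The performance of the deployed policy. -/
def M (ε : ED × EX × EY) : ℝ := S.fM (S.Pi ε)

/-- The output of the deployed policy. -/
def A (ε : ED × EX × EY) : 𝒜 := S.Pi ε (S.X ε)

/-- The observed outcome. -/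
def Y (ε : ED × EX × EY) : ℝ := S.fY (S.A ε) (S.X ε) (S.M ε) ε.2.2

/-- The potential outcome `Y(A = a, M = m)`. -/
def potential (a : 𝒜) (m : ℝ) (ε : ED × EX × EY) : ℝ := S.fY a (S.X ε) m ε.2.2

/-- The policy value `E[Y(A = πe(X), M = fM(πe))]`. -/
def policyValue (πe : 𝒳 → 𝒜) : ℝ := ∫ ε, S.potential (πe (S.X ε)) (S.fM πe) ε ∂S.law

/-! ### Assumptions on outcomes -/

/-- Potential outcomes are non-decreasing in performance, for each fixed action. -/
def PerformanceMonotone : Prop :=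
  ∀ᵐ ε ∂S.law, ∀ (a : 𝒜) (m m' : ℝ), m < m' → S.potential a m ε ≤ S.potential a m' ε

/-- Under the action `a₀` the potential outcome does not depend on performance. -/
def NeutralAction (a₀ : 𝒜) : Prop :=
  ∀ᵐ ε ∂S.law, ∀ m m' : ℝ, S.potential a₀ m ε = S.potential a₀ m' ε

/-- All potential outcomes lie in `[ymin, ymax]`. -/
def PotentialBounded (ymin ymax : ℝ) : Prop :=
  ∀ᵐ ε ∂S.law, ∀ (a : 𝒜) (m : ℝ), S.potential a m ε ∈ Set.Icc ymin ymax

/-! ### Sets of trialed policies that agree with `πe` at `x` -/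

/-- The set of trialed policies. -/
def trialed : Set (𝒳 → 𝒜) := Set.range S.pol

/-- Trialed policies whose output at `x` is that of `πe`. -/
def agree (πe : 𝒳 → 𝒜) (x : 𝒳) : Set (𝒳 → 𝒜) := {π ∈ S.trialed | π x = πe x}

/-- Those of performance at most that of `πe`. -/
def agreeLe (πe : 𝒳 → 𝒜) (x : 𝒳) : Set (𝒳 → 𝒜) :=
  {π ∈ S.trialed | π x = πe x ∧ S.fM π ≤ S.fM πe}

/-- Those of performance at least that of `πe`. -/
def agreeGe (πe : 𝒳 → 𝒜) (x : 𝒳) : Set (𝒳 → 𝒜) :=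
  {π ∈ S.trialed | π x = πe x ∧ S.fM πe ≤ S.fM π}

/-- The next-worst policies: the maximizers of performance over `agreeLe`. -/
def nextWorst (πe : 𝒳 → 𝒜) (x : 𝒳) : Set (𝒳 → 𝒜) :=
  {π ∈ S.agreeLe πe x | ∀ π' ∈ S.agreeLe πe x, S.fM π' ≤ S.fM π}

/-- The next-best policies: the minimizers of performance over `agreeGe`. -/
def nextBest (πe : 𝒳 → 𝒜) (x : 𝒳) : Set (𝒳 → 𝒜) :=
  {π ∈ S.agreeGe πe x | ∀ π' ∈ S.agreeGe πe x, S.fM π ≤ S.fM π'}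

/-! ### The bounds `L(πe)` and `U(πe)` -/

/-- `E[Y ∣ X, Π ∈ T(X)]`: the conditional expectation of `Y` given `σ(X)` under the conditional
probability given the event `{Π ∈ T(X)}`. -/
def condMean (T : 𝒳 → Set (𝒳 → 𝒜)) : ED × EX × EY → ℝ :=
  condExp (MeasurableSpace.comap S.X inferInstance)
    (ProbabilityTheory.cond S.law {ε | S.Pi ε ∈ T (S.X ε)}) S.Y

open Classical in
/-- The integrand of `L(πe)`. -/
def lowerIntegrand (a₀ : 𝒜) (ymin : ℝ) (πe : 𝒳 → 𝒜) (ε : ED × EX × EY) : ℝ :=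
  if πe (S.X ε) ≠ a₀ then
    if (S.nextWorst πe (S.X ε)).Nonempty then S.condMean (S.nextWorst πe) ε else ymin
  else
    if (S.agree πe (S.X ε)).Nonempty then S.condMean (S.agree πe) ε else ymin

open Classical in
/-- The integrand of `U(πe)`. -/
def upperIntegrand (a₀ : 𝒜) (ymax : ℝ) (πe : 𝒳 → 𝒜) (ε : ED × EX × EY) : ℝ :=
  if πe (S.X ε) ≠ a₀ then
    if (S.nextBest πe (S.X ε)).Nonempty then S.condMean (S.nextBest πe) ε else ymax
  else
    if (S.agree πe (S.X ε)).Nonempty then S.condMean (S.agree πe) ε else ymax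

/-- The lower bound `L(πe)`. -/
def lowerBound (a₀ : 𝒜) (ymin : ℝ) (πe : 𝒳 → 𝒜) : ℝ :=
  ∫ ε, S.lowerIntegrand a₀ ymin πe ε ∂S.law

/-- The upper bound `U(πe)`. -/
def upperBound (a₀ : 𝒜) (ymax : ℝ) (πe : 𝒳 → 𝒜) : ℝ :=
  ∫ ε, S.upperIntegrand a₀ ymax πe ε ∂S.law

/-! ### Inverse-probability weighting -/

/-- The assignment probability `P(Π ∈ T)` of a fixed set `T` of policies. -/
def armProb (T : Set (𝒳 → 𝒜)) : ℝ := S.law.real {ε | S.Pi ε ∈ T}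

open Classical in
/-- The inverse-probability weight `1{π ∈ T} / P(Π ∈ T)`. -/
def ipw (T : Set (𝒳 → 𝒜)) (π : 𝒳 → 𝒜) : ℝ := (if π ∈ T then 1 else 0) / S.armProb T

open Classical in
/-- The function `ψ_L(y, x, π)`. -/
def psiL (a₀ : 𝒜) (ymin : ℝ) (πe : 𝒳 → 𝒜) (y : ℝ) (x : 𝒳) (π : 𝒳 → 𝒜) : ℝ :=
  if πe x ≠ a₀ then
    if (S.nextWorst πe x).Nonempty then y * S.ipw (S.nextWorst πe x) π else ymin
  else
    if (S.agree πe x).Nonempty then y * S.ipw (S.agree πe x) π else ymin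

open Classical in
/-- The function `ψ_U(y, x, π)`. -/
def psiU (a₀ : 𝒜) (ymax : ℝ) (πe : 𝒳 → 𝒜) (y : ℝ) (x : 𝒳) (π : 𝒳 → 𝒜) : ℝ :=
  if πe x ≠ a₀ then
    if (S.nextBest πe x).Nonempty then y * S.ipw (S.nextBest πe x) π else ymax
  else
    if (S.agree πe x).Nonempty then y * S.ipw (S.agree πe x) π else ymax

end TrialSCM

/-! ### Statistics of a sample `v 0, …, v (n - 1)` -/

/-- The empirical mean. -/
def empMean (v : ℕ → ℝ) (n : ℕ) : ℝ := (n : ℝ)⁻¹ * ∑ i ∈ Finset.range n, v i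

/-- The empirical standard deviation (that of the empirical distribution). -/
def empStd (v : ℕ → ℝ) (n : ℕ) : ℝ :=
  √((n : ℝ)⁻¹ * ∑ i ∈ Finset.range n, (v i - empMean v n) ^ 2)

/-- The inverse `Φ⁻¹(p)` of the standard normal distribution function, for `0 < p < 1`. -/
def stdNormalQuantile (p : ℝ) : ℝ := sInf {z : ℝ | p ≤ cdf (gaussianReal 0 1) z}

/-- The lower end point `mean - Φ⁻¹(1 - α/2) · std / √n`. -/
def ciLower (α : ℝ) (v : ℕ → ℝ) (n : ℕ) : ℝ :=
  empMean v n - stdNormalQuantile (1 - α / 2) * (empStd v n / √(n : ℝ))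

/-- The upper end point `mean + Φ⁻¹(1 - α/2) · std / √n`. -/
def ciUpper (α : ℝ) (v : ℕ → ℝ) (n : ℕ) : ℝ :=
  empMean v n + stdNormalQuantile (1 - α / 2) * (empStd v n / √(n : ℝ))

end

/-! The cluster noise `εD` is independent of `(εX, εY)`. With the latter fixed, `1{Π ∈ T(X)} / P(Π ∈
T(X))` has mean one over `εD` whenever `T(X)` is nonempty (`integral_mul_ipw`), so weighting does
not change the mean, over `{T(X) ≠ ∅}`, of any integrable function of `(εX, εY)`.

The formulas for `L` and `U` follow in two moves (`integral_condMean_eq`). The weight is a function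
of `X` on the event `{Π ∈ T(X)}`, so `Y` may be replaced there by its conditional mean given `X`.
That mean is itself a function of `X`, so the weight then integrates away.

There are finitely many arms, so the weights are bounded and `ψ_L`, `ψ_U` are square-integrable. The
central limit theorem applies; with the strong law for the empirical deviation, Slutsky's theorem
and the portmanteau theorem, each end point errs with asymptotic probability at most `α/2`. A union
bound joins the two sides, so no joint limit law is needed.

For the policy value, monotonicity (or neutrality of `a₀`) compares `Y` with the potential outcome
of `πe` on the selected arms, pointwise. Weighting that potential outcome returns the policy value,
which therefore lies between `L` and `U`. -/

open scoped Topology ENNReal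

/-! ### Normal quantiles and one-sided confidence limits for an i.i.d. sample. -/

section Statistics

/-- Right continuity of the distribution function makes the infimum attained. -/
lemma le_cdf_stdNormalQuantile {p : ℝ} (h0 : 0 < p) (h1 : p < 1) :
    p ≤ cdf (gaussianReal 0 1) (stdNormalQuantile p) := by
  set F := cdf (gaussianReal 0 1) with hF
  have hne : {z : ℝ | p ≤ F z}.Nonempty :=
    ((tendsto_cdf_atTop (gaussianReal 0 1)).eventually_const_le h1).exists
  obtain ⟨b, hb⟩ : BddBelow {z : ℝ | p ≤ F z} := by
    obtain ⟨b, hb⟩ := ((tendsto_cdf_atBot (gaussianReal 0 1)).eventually_lt_const h0).exists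
    exact ⟨b, fun z hz => le_of_lt <| (monotone_cdf (gaussianReal 0 1)).reflect_lt
      (hb.trans_le hz)⟩
  have hq : ∀ z ∈ Set.Ioi (stdNormalQuantile p), p ≤ F z := by
    intro z hz
    obtain ⟨s, hs, hsz⟩ := (csInf_lt_iff ⟨b, hb⟩ hne).1 hz
    exact le_trans hs (monotone_cdf (gaussianReal 0 1) hsz.le)
  have hc : Tendsto F (𝓝[>] (stdNormalQuantile p)) (𝓝 (F (stdNormalQuantile p))) :=
    ((F.right_continuous _).mono Set.Ioi_subset_Ici_self)
  exact ge_of_tendsto hc (eventually_nhdsWithin_of_forall hq)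

lemma gaussianReal_Iic_neg_stdNormalQuantile_le {p : ℝ} (h0 : 0 < p) (h1 : p < 1) :
    gaussianReal 0 1 (Set.Iic (-stdNormalQuantile p)) ≤ ENNReal.ofReal (1 - p) := by
  set z := stdNormalQuantile p
  have hsymm : gaussianReal 0 1 (Set.Iic (-z)) = gaussianReal 0 1 (Set.Ici z) := by
    conv_lhs => rw [← neg_zero, ← gaussianReal_map_neg,
      Measure.map_apply (by fun_prop) measurableSet_Iic]
    congr 1
    ext x
    simp
  have : NullSingletonClass (gaussianReal 0 1) := nullSingletonClass_gaussianReal (by simp)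
  have hc : gaussianReal 0 1 (Set.Ici z) = 1 - gaussianReal 0 1 (Set.Iic z) := by
    rw [measure_congr Ioi_ae_eq_Ici.symm, ← Set.compl_Iic, prob_compl_eq_one_sub measurableSet_Iic]
  rw [hsymm, hc, ← ofReal_cdf, ← ENNReal.ofReal_one, ← ENNReal.ofReal_sub _ (cdf_nonneg _ _)]
  exact ENNReal.ofReal_le_ofReal (by linarith [le_cdf_stdNormalQuantile h0 h1])

lemma empStd_eq {v : ℕ → ℝ} {n : ℕ} (hn : n ≠ 0) :
    empStd v n = √((n : ℝ)⁻¹ * ∑ i ∈ Finset.range n, v i ^ 2 - empMean v n ^ 2) := by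
  have hn' : (n : ℝ) ≠ 0 := by exact_mod_cast hn
  have hs : ∑ i ∈ Finset.range n, v i = n * empMean v n := by
    unfold empMean; field_simp
  unfold empStd
  congr 1
  simp only [sub_sq, Finset.sum_add_distrib, Finset.sum_sub_distrib, ← Finset.mul_sum,
    ← Finset.sum_mul, hs]
  simp
  field_simp
  ring

lemma empMean_neg (v : ℕ → ℝ) (n : ℕ) : empMean (fun i => -v i) n = -empMean v n := by
  simp [empMean]

lemma empStd_neg (v : ℕ → ℝ) (n : ℕ) : empStd (fun i => -v i) n = empStd v n := by
  unfold empStd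
  simp only [empMean_neg]
  congr 3
  ext i
  ring

/-- Lets the upper error be read off from the lower one by reflecting the sample. -/
lemma ciLower_neg (α : ℝ) (v : ℕ → ℝ) (n : ℕ) :
    ciLower α (fun i => -v i) n = -ciUpper α v n := by
  unfold ciLower ciUpper
  rw [empMean_neg, empStd_neg]
  ring

variable {Ω : Type*} [MeasurableSpace Ω] {P : Measure Ω} [IsProbabilityMeasure P]
  {X : ℕ → Ω → ℝ}

theorem tendstoInDistribution_sqrt_mul_sub_empMean (hX : MemLp (X 0) 2 P)
    (hindep : iIndepFun X P) (hident : ∀ i, IdentDistrib (X i) (X 0) P P) :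
    TendstoInDistribution
      (fun (n : ℕ) ω => √(n : ℝ) * (P[X 0] - empMean (fun i => X i ω) n)) atTop
      id (fun _ => P) (gaussianReal 0 Var[X 0; P].toNNReal) := by
  -- The statistic is mean minus average, opposite in sign to the usual one. Taking `-x` as the
  -- limit variable makes the limit exactly `id` after composing with negation.
  have hlaw : HasLaw (fun x : ℝ => -x) (gaussianReal 0 Var[X 0; P].toNNReal)
      (gaussianReal 0 Var[X 0; P].toNNReal) :=
    ⟨by fun_prop, by rw [gaussianReal_map_neg, neg_zero]⟩
  have hclt := (tendstoInDistribution_inv_sqrt_mul_sum_sub hlaw hX hindep hident).continuous_comp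
    (g := fun x => -x) continuous_neg
  convert! hclt using 3 with n ω x
  · rcases Nat.eq_zero_or_pos n with rfl | hn
    · simp
    · have h1 : √(n : ℝ) ≠ 0 := by positivity
      have h2 : √(n : ℝ) ^ 2 = n := Real.sq_sqrt (by positivity)
      have h3 : (n : ℝ) ≠ 0 := by positivity
      simp only [empMean, Function.comp]
      field_simp
      rw [h2]
      ring
  · simp

/-- The strong law applies to the sample and to its squares. -/
theorem ae_tendsto_empStd (hX : MemLp (X 0) 2 P)
    (hindep : iIndepFun X P) (hident : ∀ i, IdentDistrib (X i) (X 0) P P) :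
    ∀ᵐ ω ∂P, Tendsto (fun n => empStd (fun i => X i ω) n) atTop (𝓝 √(Var[X 0; P])) := by
  have h1 := strong_law_ae X (hX.integrable (by norm_num))
    (fun i j hij => hindep.indepFun hij) hident
  have h2 := strong_law_ae (fun i ω => X i ω ^ 2) hX.integrable_sq
    (fun i j hij => (hindep.indepFun hij).comp (φ := fun x : ℝ => x ^ 2) (ψ := fun x : ℝ => x ^ 2)
      (by fun_prop) (by fun_prop))
    (fun i => (hident i).comp (u := fun x : ℝ => x ^ 2) (by fun_prop))
  filter_upwards [h1, h2] with ω hω1 hω2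
  have hv : Var[X 0; P] = ∫ ω, X 0 ω ^ 2 ∂P - (∫ ω, X 0 ω ∂P) ^ 2 := by
    rw [variance_eq_sub hX]; rfl
  rw [hv]
  refine Tendsto.congr' ?_ ((hω2.sub (hω1.pow 2)).sqrt)
  filter_upwards [eventually_ne_atTop 0] with n hn
  rw [empStd_eq hn]
  rfl

/-- After scaling by `√n`, the error event forces `√n (μ - mean) + z · std ≤ 0`. By Slutsky the left
side tends in law to `σ Z + z σ` with `Z` standard normal, and the portmanteau bound for a closed
half-line gives at most `P(Z ≤ -z) ≤ α/2`. -/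
theorem limsup_measure_lt_ciLower_le (hX : MemLp (X 0) 2 P)
    (hindep : iIndepFun X P) (hident : ∀ i, IdentDistrib (X i) (X 0) P P)
    {α : ℝ} (hα : α ∈ Set.Ioo (0 : ℝ) 1) :
    limsup (fun n : ℕ => P {ω | P[X 0] < ciLower α (fun i => X i ω) n}) atTop
      ≤ ENNReal.ofReal (α / 2) := by
  set z := stdNormalQuantile (1 - α / 2) with hz
  set σ := √Var[X 0; P] with hσ
  have mX (i) : AEMeasurable (X i) P := (hident i).aemeasurable_fst
  -- With zero variance one cannot divide by `σ`; but then the sample is almost surely constant, the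
  -- end point equals the mean, and the strict error event is null.
  rcases eq_or_ne Var[X 0; P] 0 with h0 | h0
  · have hconst : ∀ᵐ ω ∂P, ∀ i, X i ω = P[X 0] := by
      refine ae_all_iff.2 fun i => ?_
      have := ae_eq_integral_of_variance_eq_zero ((hident i).memLp_iff.2 hX)
        (by rw [(hident i).variance_eq, h0])
      rwa [(hident i).integral_eq] at this
    have hzero : ∀ᶠ n : ℕ in atTop,
        P {ω | P[X 0] < ciLower α (fun i => X i ω) n} = 0 := by
      filter_upwards [eventually_ne_atTop 0] with n hn
      rw [measure_eq_zero_iff_ae_notMem]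
      filter_upwards [hconst] with ω hω
      have hn' : (n : ℝ) ≠ 0 := by exact_mod_cast hn
      simp [ciLower, empStd, empMean, hω, hn']
    rw [limsup_congr hzero]
    simp
  have hpos : 0 < Var[X 0; P] := lt_of_le_of_ne (variance_nonneg _ _) h0.symm
  have hσpos : 0 < σ := Real.sqrt_pos.2 hpos
  have hmeas (n : ℕ) : AEMeasurable (fun ω => empStd (fun i => X i ω) n) P := by
    unfold empStd empMean
    fun_prop
  have hstd : TendstoInMeasure P (fun n ω => empStd (fun i => X i ω) n) atTop (fun _ => σ) :=
    tendstoInMeasure_of_tendsto_ae (fun n => (hmeas n).aestronglyMeasurable)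
      (ae_tendsto_empStd hX hindep hident)
  have hslutsky := (tendstoInDistribution_sqrt_mul_sub_empMean hX hindep
    hident).continuous_comp_prodMk_of_tendstoInMeasure_const
    (g := fun p : ℝ × ℝ => p.1 + z * p.2) (by fun_prop) hstd hmeas
  have hport := ProbabilityMeasure.limsup_measure_closed_le_of_tendsto hslutsky.tendsto
    (isClosed_Iic (a := (0 : ℝ)))
  have hlim : (gaussianReal 0 Var[X 0; P].toNNReal).map (fun x => id x + z * σ) (Set.Iic 0)
      ≤ ENNReal.ofReal (α / 2) := by
    have hscale : gaussianReal 0 Var[X 0; P].toNNReal = (gaussianReal 0 1).map (fun x => σ * x) := by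
      rw [gaussianReal_map_const_mul, mul_zero, mul_one]
      congr 1
      ext
      simp [hσ, Real.sq_sqrt hpos.le, hpos.le]
    rw [hscale, Measure.map_map (by fun_prop) (by fun_prop),
      Measure.map_apply (by fun_prop) measurableSet_Iic]
    have hset : ((fun x => id x + z * σ) ∘ fun x => σ * x) ⁻¹' Set.Iic 0 = Set.Iic (-z) := by
      ext x
      simp only [Set.mem_preimage, Function.comp, id, Set.mem_Iic]
      constructor <;> intro h <;> nlinarith
    rw [hset]
    have := gaussianReal_Iic_neg_stdNormalQuantile_le (p := 1 - α / 2)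
      (by linarith [hα.2]) (by linarith [hα.1])
    simpa using this
  refine le_trans ?_ (hport.trans hlim)
  refine limsup_le_limsup ?_
  filter_upwards [eventually_ne_atTop 0] with n hn
  simp only [ProbabilityMeasure.coe_mk]
  rw [Measure.map_apply_of_aemeasurable (hslutsky.forall_aemeasurable n) measurableSet_Iic]
  refine measure_mono fun ω hω => ?_
  have hsq : 0 < √(n : ℝ) := by positivity
  simp only [Set.mem_ofPred_eq, ciLower] at hω
  simp only [Set.mem_preimage, Set.mem_Iic]
  rw [← sub_pos] at hω
  have h := mul_pos hsq hω
  have h2 : √(n : ℝ) * (z * (empStd (fun i => X i ω) n / √(n : ℝ)))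
      = z * empStd (fun i => X i ω) n := by field_simp
  rw [← hz] at h
  linarith

theorem limsup_measure_ciUpper_lt_le (hX : MemLp (X 0) 2 P)
    (hindep : iIndepFun X P) (hident : ∀ i, IdentDistrib (X i) (X 0) P P)
    {α : ℝ} (hα : α ∈ Set.Ioo (0 : ℝ) 1) :
    limsup (fun n : ℕ => P {ω | ciUpper α (fun i => X i ω) n < P[X 0]}) atTop
      ≤ ENNReal.ofReal (α / 2) := by
  have h := limsup_measure_lt_ciLower_le (X := fun i ω => -X i ω) (P := P) hX.neg
    (hindep.comp (fun _ x => -x) (fun _ => measurable_neg))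
    (fun i => (hident i).comp measurable_neg) hα
  simpa only [integral_neg, ciLower_neg, neg_lt_neg_iff] using h

/-- The union bound for one-sided errors of asymptotic levels `a` and `b`. -/
lemma ofReal_one_sub_le_liminf_measure {A B C : ℕ → Set Ω} {a b : ℝ} (ha : 0 ≤ a) (hb : 0 ≤ b)
    (hA : limsup (fun n => P (A n)) atTop ≤ ENNReal.ofReal a)
    (hB : limsup (fun n => P (B n)) atTop ≤ ENNReal.ofReal b)
    (hC : ∀ n, (A n ∪ B n)ᶜ ⊆ C n) :
    ENNReal.ofReal (1 - (a + b)) ≤ liminf (fun n => P (C n)) atTop := by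
  -- A slack of `ε/2` on each side turns the limsup bounds into bounds for all large `n`.
  refine ENNReal.le_of_forall_pos_le_add fun ε hε _ => ?_
  have hε2 : (0 : ℝ) < ε / 2 := by positivity
  have hA' := eventually_lt_of_limsup_lt (hA.trans_lt
    (ENNReal.ofReal_lt_ofReal_iff_of_nonneg ha |>.2 (lt_add_of_pos_right a hε2)))
  have hB' := eventually_lt_of_limsup_lt (hB.trans_lt
    (ENNReal.ofReal_lt_ofReal_iff_of_nonneg hb |>.2 (lt_add_of_pos_right b hε2)))
  rw [← tsub_le_iff_right]
  refine le_liminf_of_le (by isBoundedDefault) ?_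
  filter_upwards [hA', hB'] with n hAn hBn
  have huniv : (1 : ℝ≥0∞) ≤ P (A n) + P (B n) + P (C n) := by
    rw [← measure_univ (μ := P)]
    refine (measure_mono fun ω _ => ?_).trans ((measure_union_le _ _).trans
      (add_le_add_left (measure_union_le (A n) (B n)) (P (C n))))
    by_cases h : ω ∈ A n ∪ B n
    · exact Or.inl h
    · exact Or.inr (hC n h)
  have hsum : (1 : ℝ≥0∞) ≤ ENNReal.ofReal (a + b + ε) + P (C n) := by
    refine huniv.trans (add_le_add_left ?_ _)
    have : a + b + (ε : ℝ) = (a + ε / 2) + (b + ε / 2) := by ring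
    rw [this, ENNReal.ofReal_add (by positivity) (by positivity)]
    exact add_le_add hAn.le hBn.le
  rw [tsub_le_iff_right]
  -- `1 - (a + b + ε)` may be negative; subadditivity of `ENNReal.ofReal` needs no sign.
  have hlt : ENNReal.ofReal (1 - (a + b)) ≤ 1 - ENNReal.ofReal (a + b + ε) + ε := by
    have : ENNReal.ofReal (1 - (a + b)) = ENNReal.ofReal ((1 - (a + b + ε)) + ε) := by ring_nf
    rw [this]
    refine (ENNReal.ofReal_add_le).trans ?_
    rw [ENNReal.ofReal_sub _ (by positivity), ENNReal.ofReal_one, ENNReal.ofReal_coe_nnreal]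
  exact hlt.trans (add_le_add_left (tsub_le_iff_left.2 hsum) _)

end Statistics

/-! ### Measurable selections of arms and inverse-probability weighting. -/

section Trial

/-- No σ-algebra on `β` is involved: policies and sets of policies enter only through finitely many
values with measurable fibres. -/
lemma measurable_comp_of_finite_range {α β γ : Type*} [MeasurableSpace α] [MeasurableSpace γ]
    {f : α → β} (hf : (Set.range f).Finite) (hm : ∀ b, MeasurableSet {a | f a = b}) (g : β → γ) :
    Measurable fun a => g (f a) := by
  intro s _
  have : (fun a => g (f a)) ⁻¹' s = ⋃ b ∈ Set.range f ∩ g ⁻¹' s, {a | f a = b} := by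
    ext a
    simp
  rw [this]
  exact (hf.inter_of_left _).measurableSet_biUnion fun b _ => hm b

namespace TrialSCM

variable {ED EX EY 𝒟 𝒳 𝒜 : Type*} [MeasurableSpace ED] [MeasurableSpace EX]
  [MeasurableSpace EY] [MeasurableSpace 𝒟] [MeasurableSpace 𝒳] [MeasurableSpace 𝒜]
  (S : TrialSCM ED EX EY 𝒟 𝒳 𝒜)

/-- A measurable selection of sets of trialed policies. -/
structure IsSelection (T : 𝒳 → Set (𝒳 → 𝒜)) : Prop where
  subset : ∀ x, T x ⊆ S.trialed
  measurableSet_mem : ∀ π ∈ S.trialed, MeasurableSet {x | π ∈ T x}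

lemma measurable_of_mem_trialed {π : 𝒳 → 𝒜} (h : π ∈ S.trialed) : Measurable π := by
  obtain ⟨d, rfl⟩ := h
  exact S.measurable_pol d

lemma measurable_X : Measurable S.X := S.measurable_fX.comp (by fun_prop)

lemma measurable_D : Measurable S.D := S.measurable_fD.comp (by fun_prop)

section Selections

variable [MeasurableEq 𝒜] {πe : 𝒳 → 𝒜}

lemma isSelection_agree (hπe : Measurable πe) : S.IsSelection (S.agree πe) where
  subset _ _ h := h.1
  measurableSet_mem π hπ := by
    have : {x | π ∈ S.agree πe x} = {x | π x = πe x} := by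
      ext x; simp [agree, hπ]
    rw [this]
    exact measurableSet_eq_fun (S.measurable_of_mem_trialed hπ) hπe

/-- Maximality is tested against finitely many trialed policies, and only the agreement conditions
depend on `x`. -/
lemma isSelection_nextWorst (hπe : Measurable πe) : S.IsSelection (S.nextWorst πe) where
  subset _ _ h := h.1.1
  measurableSet_mem π hπ := by
    have : {x | π ∈ S.nextWorst πe x} = {x | π x = πe x ∧ S.fM π ≤ S.fM πe} ∩
        ⋂ π' ∈ S.trialed, {x | π' x = πe x → S.fM π' ≤ S.fM πe → S.fM π' ≤ S.fM π} := by
      ext x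
      simp only [nextWorst, agreeLe, hπ, Set.mem_ofPred_eq, Set.mem_inter_iff, Set.mem_iInter,
        true_and]
      exact and_congr_right fun _ => ⟨fun h i a b c => h i ⟨a, b, c⟩, fun h i a => h i a.1 a.2.1 a.2.2⟩
    rw [this]
    refine MeasurableSet.inter ?_ (S.finite_range_pol.measurableSet_biInter fun π' hπ' => ?_)
    · exact (measurableSet_eq_fun (S.measurable_of_mem_trialed hπ) hπe).inter (.const _)
    · simp only [imp_iff_not_or (a := _ = _)]
      exact (measurableSet_eq_fun (S.measurable_of_mem_trialed hπ') hπe).compl.union (.const _)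

lemma isSelection_nextBest (hπe : Measurable πe) : S.IsSelection (S.nextBest πe) where
  subset _ _ h := h.1.1
  measurableSet_mem π hπ := by
    have : {x | π ∈ S.nextBest πe x} = {x | π x = πe x ∧ S.fM πe ≤ S.fM π} ∩
        ⋂ π' ∈ S.trialed, {x | π' x = πe x → S.fM πe ≤ S.fM π' → S.fM π ≤ S.fM π'} := by
      ext x
      simp only [nextBest, agreeGe, hπ, Set.mem_ofPred_eq, Set.mem_inter_iff, Set.mem_iInter,
        true_and]
      exact and_congr_right fun _ => ⟨fun h i a b c => h i ⟨a, b, c⟩, fun h i a => h i a.1 a.2.1 a.2.2⟩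
    rw [this]
    refine MeasurableSet.inter ?_ (S.finite_range_pol.measurableSet_biInter fun π' hπ' => ?_)
    · exact (measurableSet_eq_fun (S.measurable_of_mem_trialed hπ) hπe).inter (.const _)
    · simp only [imp_iff_not_or (a := _ = _)]
      exact (measurableSet_eq_fun (S.measurable_of_mem_trialed hπ') hπe).compl.union (.const _)

end Selections

namespace IsSelection

variable {S} {T : 𝒳 → Set (𝒳 → 𝒜)}

lemma finite_range (hT : S.IsSelection T) : (Set.range T).Finite :=
  S.finite_range_pol.finite_subsets.subset (by rintro _ ⟨x, rfl⟩; exact hT.subset x)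

lemma measurableSet_eq (hT : S.IsSelection T) (V : Set (𝒳 → 𝒜)) : MeasurableSet {x | T x = V} := by
  by_cases hV : V ⊆ S.trialed
  · have : {x | T x = V} = ⋂ π ∈ S.trialed, {x | π ∈ T x ↔ π ∈ V} := by
      ext x
      simp only [Set.mem_ofPred_eq, Set.mem_iInter]
      refine ⟨fun h π _ => by rw [h], fun h => Set.ext fun π => ?_⟩
      by_cases hπ : π ∈ S.trialed
      · exact h π hπ
      · exact iff_of_false (fun h' => hπ (hT.subset x h')) (fun h' => hπ (hV h'))
    rw [this]
    refine S.finite_range_pol.measurableSet_biInter fun π hπ => ?_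
    by_cases hπV : π ∈ V
    · simpa [hπV] using hT.measurableSet_mem π hπ
    · simp only [hπV, iff_false]
      exact (hT.measurableSet_mem π hπ).compl
  · convert MeasurableSet.empty
    ext x
    simp only [Set.mem_ofPred_eq, Set.mem_empty_iff_false, iff_false]
    rintro rfl
    exact hV (hT.subset x)

lemma measurable_comp {γ : Type*} [MeasurableSpace γ] (hT : S.IsSelection T)
    (g : Set (𝒳 → 𝒜) → γ) : Measurable fun x => g (T x) :=
  measurable_comp_of_finite_range hT.finite_range hT.measurableSet_eq g

lemma measurableSet_nonempty (hT : S.IsSelection T) : MeasurableSet {x | (T x).Nonempty} :=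
  measurableSet_setOfPred.2 (hT.measurable_comp fun V => V.Nonempty)

lemma measurable_comp_pol {γ : Type*} [MeasurableSpace γ] (hT : S.IsSelection T)
    (g : Set (𝒳 → 𝒜) → (𝒳 → 𝒜) → γ) :
    Measurable fun p : 𝒳 × 𝒟 => g (T p.1) (S.pol p.2) := by
  refine measurable_comp_of_finite_range (f := fun p : 𝒳 × 𝒟 => (T p.1, S.pol p.2))
    ((hT.finite_range.prod S.finite_range_pol).subset ?_) ?_ (fun q => g q.1 q.2)
  · rintro _ ⟨p, rfl⟩
    exact ⟨⟨_, rfl⟩, ⟨_, rfl⟩⟩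
  · rintro ⟨V, π⟩
    simp only [Prod.mk.injEq]
    exact (measurable_fst (hT.measurableSet_eq V)).inter (measurable_snd (S.measurableSet_arm π))

lemma measurable_comp_Pi {γ : Type*} [MeasurableSpace γ] (hT : S.IsSelection T)
    (g : Set (𝒳 → 𝒜) → (𝒳 → 𝒜) → γ) : Measurable fun ε => g (T (S.X ε)) (S.Pi ε) :=
  (hT.measurable_comp_pol g).comp (S.measurable_X.prodMk S.measurable_D)

lemma measurableSet_Pi_mem (hT : S.IsSelection T) :
    MeasurableSet {ε | S.Pi ε ∈ T (S.X ε)} :=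
  measurableSet_setOfPred.2 (hT.measurable_comp_Pi fun V π => π ∈ V)

lemma exists_abs_ipw_le (hT : S.IsSelection T) :
    ∃ K, ∀ x d, |S.ipw (T x) (S.pol d)| ≤ K := by
  obtain ⟨K, hK⟩ := ((hT.finite_range.prod S.finite_range_pol).image
    (fun q => |S.ipw q.1 q.2|)).bddAbove
  exact ⟨K, fun x d => hK ⟨(T x, S.pol d), ⟨⟨_, rfl⟩, ⟨_, rfl⟩⟩, rfl⟩⟩

end IsSelection

lemma ipw_of_notMem {V : Set (𝒳 → 𝒜)} {π : 𝒳 → 𝒜} (h : π ∉ V) : S.ipw V π = 0 := by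
  simp [ipw, h]

lemma ipw_of_mem {V : Set (𝒳 → 𝒜)} {π : 𝒳 → 𝒜} (h : π ∈ V) : S.ipw V π = (S.armProb V)⁻¹ := by
  simp [ipw, h]

lemma ipw_nonneg (V : Set (𝒳 → 𝒜)) (π : 𝒳 → 𝒜) : 0 ≤ S.ipw V π := by
  unfold ipw armProb
  positivity

lemma measurableSet_pol_mem {V : Set (𝒳 → 𝒜)} (hV : V ⊆ S.trialed) :
    MeasurableSet {d | S.pol d ∈ V} := by
  have : {d | S.pol d ∈ V} = ⋃ π ∈ V, {d | S.pol d = π} := by ext; simp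
  rw [this]
  exact (S.finite_range_pol.subset hV).measurableSet_biUnion fun π _ => S.measurableSet_arm π

/-- Positivity of the arms makes the denominator nonzero as soon as `V` is nonempty; for `V = ∅` the
weight is zero. -/
lemma integral_ipw (hpos : ∀ π ∈ S.trialed, 0 < S.law {ε | S.Pi ε = π}) {V : Set (𝒳 → 𝒜)}
    (hV : V ⊆ S.trialed) (hne : V.Nonempty) : ∫ e, S.ipw V (S.pol (S.fD e)) ∂S.νD = 1 := by
  have := S.isProbabilityMeasure_νD
  have := S.isProbabilityMeasure_νX
  have := S.isProbabilityMeasure_νY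
  have hm : MeasurableSet {e | S.pol (S.fD e) ∈ V} := S.measurable_fD (S.measurableSet_pol_mem hV)
  have hprob : S.armProb V = S.νD.real {e | S.pol (S.fD e) ∈ V} := by
    unfold armProb Measure.real law
    rw [← (measurePreserving_fst (μ := S.νD) (ν := S.νX.prod S.νY)).measure_preimage
      hm.nullMeasurableSet]
    rfl
  have hprob_pos : S.armProb V ≠ 0 := by
    obtain ⟨π, hπ⟩ := hne
    have h : 0 < S.law {ε | S.Pi ε ∈ V} :=
      (hpos π (hV hπ)).trans_le (measure_mono fun ε (hε : S.Pi ε = π) => by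
        simpa [hε] using hπ)
    exact (ENNReal.toReal_pos h.ne' (measure_ne_top _ _)).ne'
  have hfun : (fun e => S.ipw V (S.pol (S.fD e)))
      = {e | S.pol (S.fD e) ∈ V}.indicator fun _ => (S.armProb V)⁻¹ := by
    ext e
    by_cases h : S.pol (S.fD e) ∈ V
    · simp [h, S.ipw_of_mem h]
    · simp [h, S.ipw_of_notMem h]
  rw [hfun, integral_indicator_const _ hm, ← hprob, smul_eq_mul, mul_inv_cancel₀ hprob_pos]

open Classical in
/-- Inverse-probability weights integrate to one, conditionally on the noises other than `εD`. -/
lemma integral_mul_ipw (hpos : ∀ π ∈ S.trialed, 0 < S.law {ε | S.Pi ε = π})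
    {T : 𝒳 → Set (𝒳 → 𝒜)} (hT : S.IsSelection T) {F : EX × EY → ℝ}
    (hF : Integrable (fun ε : ED × EX × EY => F ε.2) S.law) :
    ∫ ε, F ε.2 * S.ipw (T (S.X ε)) (S.Pi ε) ∂S.law
      = ∫ ε, (if (T (S.X ε)).Nonempty then F ε.2 else 0) ∂S.law := by
  have := S.isProbabilityMeasure_νD
  have := S.isProbabilityMeasure_νX
  have := S.isProbabilityMeasure_νY
  obtain ⟨K, hK⟩ := hT.exists_abs_ipw_le
  have hint : Integrable (fun ε => F ε.2 * S.ipw (T (S.X ε)) (S.Pi ε)) S.law :=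
    hF.mul_bdd (c := K) (hT.measurable_comp_Pi S.ipw).aestronglyMeasurable
      (ae_of_all _ fun ε => hK _ _)
  have hsnd : ∫ ε, (if (T (S.X ε)).Nonempty then F ε.2 else 0) ∂S.law
      = ∫ p : EX × EY, (if (T (S.fX p.1)).Nonempty then F p else 0) ∂(S.νX.prod S.νY) := by
    unfold law
    have := integral_fun_snd (μ := S.νD) (ν := S.νX.prod S.νY)
      (fun p : EX × EY => if (T (S.fX p.1)).Nonempty then F p else 0)
    rw [probReal_univ, one_smul] at this
    exact this
  rw [hsnd]
  unfold law at hint ⊢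
  -- Fubini with `εD` innermost, where `F` and `T(X)` are constant.
  rw [integral_prod_symm _ hint]
  refine integral_congr_ae (ae_of_all _ fun p => ?_)
  simp only [Pi, D, X, integral_const_mul]
  split_ifs with h
  · rw [S.integral_ipw hpos (hT.subset _) h, mul_one]
  · rw [Set.not_nonempty_iff_eq_empty] at h
    simp [h, ipw]

lemma measurable_condMean (T : 𝒳 → Set (𝒳 → 𝒜)) :
    Measurable[MeasurableSpace.comap S.X inferInstance] (S.condMean T) :=
  stronglyMeasurable_condExp.measurable

open Classical in
-- The conditional law controls `condMean` only on `{Π ∈ T(X)}`. The exceptional set `N` depends on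
-- `X` alone, so its weighted indicator, which has integral zero, also has integral `P(N)`; hence
-- the bound extends to `{T(X) ≠ ∅}`.
lemma ae_abs_condMean_le (hpos : ∀ π ∈ S.trialed, 0 < S.law {ε | S.Pi ε = π})
    {T : 𝒳 → Set (𝒳 → 𝒜)} (hT : S.IsSelection T) {C : ℝ} (hC : ∀ᵐ ε ∂S.law, |S.Y ε| ≤ C) :
    ∀ᵐ ε ∂S.law, (T (S.X ε)).Nonempty → |S.condMean T ε| ≤ C := by
  obtain ⟨h, hm, hh⟩ := (S.measurable_condMean T).exists_eq_measurable_comp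
  have hE := hT.measurableSet_Pi_mem
  have hQ : ∀ᵐ ε ∂(ProbabilityTheory.cond S.law {ε | S.Pi ε ∈ T (S.X ε)}),
      |S.condMean T ε| ≤ C :=
    ae_bdd_abs_condExp_of_ae_bdd_abs (cond_absolutelyContinuous.ae_le hC)
  rw [ProbabilityTheory.cond, Measure.ae_ennreal_smul_measure_iff
    (ENNReal.inv_ne_zero.2 (measure_ne_top _ _)), ae_restrict_iff' hE] at hQ
  set N : Set (EX × EY) := {p | (T (S.fX p.1)).Nonempty ∧ C < |h (S.fX p.1)|} with hN
  have hNm : MeasurableSet N := by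
    have h1 : Measurable fun p : EX × EY => S.fX p.1 := S.measurable_fX.comp measurable_fst
    exact (h1 hT.measurableSet_nonempty).inter
      (measurableSet_lt measurable_const ((hm.comp h1).abs))
  have hNm' : MeasurableSet {ε : ED × EX × EY | ε.2 ∈ N} := measurable_snd hNm
  have hFm : Measurable (N.indicator fun _ => (1 : ℝ)) := measurable_const.indicator hNm
  have hF : Integrable (fun ε : ED × EX × EY => N.indicator (fun _ => (1 : ℝ)) ε.2) S.law :=
    Integrable.of_bound (hFm.comp measurable_snd).aestronglyMeasurable 1 (ae_of_all _ fun ε => by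
      by_cases hε : ε.2 ∈ N <;> simp [hε])
  have hkey := S.integral_mul_ipw hpos hT hF
  have hzero : ∫ ε, N.indicator (fun _ => (1 : ℝ)) ε.2 * S.ipw (T (S.X ε)) (S.Pi ε) ∂S.law = 0 := by
    refine integral_eq_zero_of_ae ?_
    filter_upwards [hQ] with ε hε
    by_cases hmem : S.Pi ε ∈ T (S.X ε)
    · have : ε.2 ∉ N := fun hN' => by
        have h1 := hε hmem
        rw [hh] at h1
        exact absurd hN'.2 (not_lt.2 h1)
      simp [this]
    · simp [S.ipw_of_notMem hmem]
  have hind : ∀ ε : ED × EX × EY, (if (T (S.X ε)).Nonempty then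
      N.indicator (fun _ => (1 : ℝ)) ε.2 else 0)
      = {ε : ED × EX × EY | ε.2 ∈ N}.indicator (fun _ => (1 : ℝ)) ε := by
    intro ε
    by_cases hε : ε.2 ∈ N
    · have : (T (S.X ε)).Nonempty := hε.1
      simp [hε, this]
    · simp [hε]
  have hNzero : S.law {ε : ED × EX × EY | ε.2 ∈ N} = 0 := by
    rw [hzero] at hkey
    simp only [hind] at hkey
    rw [integral_indicator_const _ hNm', smul_eq_mul, mul_one, eq_comm,
      measureReal_eq_zero_iff] at hkey
    exact hkey
  rw [measure_eq_zero_iff_ae_notMem] at hNzero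
  filter_upwards [hNzero] with ε hε hne
  by_contra hlt
  rw [hh] at hlt
  exact hε ⟨hne, not_le.1 hlt⟩

lemma setIntegral_eq_mul_integral_cond {Ω : Type*} [MeasurableSpace Ω] (μ : Measure Ω)
    [IsFiniteMeasure μ] (E : Set Ω) (f : Ω → ℝ) :
    ∫ x in E, f x ∂μ = μ.real E * ∫ x, f x ∂(ProbabilityTheory.cond μ E) := by
  rw [ProbabilityTheory.cond, integral_smul_measure, ENNReal.toReal_inv, smul_eq_mul,
    ← mul_assoc]
  by_cases h : μ E = 0
  · simp [Measure.restrict_eq_zero.2 h]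
  · rw [← measureReal_def, mul_inv_cancel₀, one_mul]
    exact (ENNReal.toReal_pos h (measure_ne_top _ _)).ne'

open Classical in
/-- Inverse-probability weighting recovers the conditional means, on events in `σ(X)`. -/
lemma integral_condMean_eq (hpos : ∀ π ∈ S.trialed, 0 < S.law {ε | S.Pi ε = π})
    {T : 𝒳 → Set (𝒳 → 𝒜)} (hT : S.IsSelection T) {C : ℝ} (hC : ∀ᵐ ε ∂S.law, |S.Y ε| ≤ C)
    (hYm : AEMeasurable S.Y S.law) {G : Set 𝒳} (hG : MeasurableSet G) :
    ∫ ε, (if S.X ε ∈ G ∧ (T (S.X ε)).Nonempty then S.condMean T ε else 0) ∂S.law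
      = ∫ ε, (if S.X ε ∈ G ∧ (T (S.X ε)).Nonempty then
          S.Y ε * S.ipw (T (S.X ε)) (S.Pi ε) else 0) ∂S.law := by
  set E := {ε | S.Pi ε ∈ T (S.X ε)} with hEdef
  have hE : MeasurableSet E := hT.measurableSet_Pi_mem
  obtain ⟨h, hm, hh⟩ := (S.measurable_condMean T).exists_eq_measurable_comp
  have hYint : Integrable S.Y (ProbabilityTheory.cond S.law E) :=
    Integrable.of_bound (hYm.mono_ac cond_absolutelyContinuous).aestronglyMeasurable C
      (cond_absolutelyContinuous.ae_le hC)
  -- On `E` the weight is a bounded function of `X`, hence can be pulled out of conditional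
  -- expectations given `σ(X)`.
  set k : 𝒳 → ℝ := G.indicator fun x => (S.armProb (T x))⁻¹ with hk
  have hkm : Measurable k := (hT.measurable_comp fun V => (S.armProb V)⁻¹).indicator hG
  obtain ⟨K, hK⟩ : ∃ K, ∀ x, |k x| ≤ K := by
    obtain ⟨K, hK⟩ := (hT.finite_range.image (fun V => |(S.armProb V)⁻¹|)).bddAbove
    refine ⟨max K 0, fun x => ?_⟩
    by_cases hx : x ∈ G
    · simpa [k, hx] using Or.inl (hK ⟨T x, ⟨x, rfl⟩, rfl⟩)
    · simp [k, hx]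
  have hweight (f : ED × EX × EY → ℝ) :
      ∫ ε, (if S.X ε ∈ G ∧ (T (S.X ε)).Nonempty then
          f ε * S.ipw (T (S.X ε)) (S.Pi ε) else 0) ∂S.law
        = ∫ ε in E, k (S.X ε) * f ε ∂S.law := by
    rw [← integral_indicator hE]
    congr 1
    ext ε
    by_cases hmem : S.Pi ε ∈ T (S.X ε)
    · have hne : (T (S.X ε)).Nonempty := ⟨_, hmem⟩
      have hmemE : ε ∈ E := hmem
      by_cases hx : S.X ε ∈ G
      · simp [hx, hne, hmemE, k, S.ipw_of_mem hmem, mul_comm]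
      · simp [hx, hmemE, k]
    · have hmemE : ε ∉ E := hmem
      simp [hmemE, S.ipw_of_notMem hmem]
  have hkX : StronglyMeasurable[MeasurableSpace.comap S.X inferInstance] fun ε => k (S.X ε) :=
    (hkm.comp (comap_measurable S.X)).stronglyMeasurable
  have hpull : ∫ ε, k (S.X ε) * S.Y ε ∂(ProbabilityTheory.cond S.law E)
      = ∫ ε, k (S.X ε) * S.condMean T ε ∂(ProbabilityTheory.cond S.law E) := by
    rw [← integral_condExp S.measurable_X.comap_le]
    exact integral_congr_ae (condExp_stronglyMeasurable_mul_of_bound S.measurable_X.comap_le hkX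
      hYint K (ae_of_all _ fun ε => hK _))
  rw [hweight, setIntegral_eq_mul_integral_cond, hpull, ← setIntegral_eq_mul_integral_cond,
    ← hweight]
  have hX : Measurable fun p : EX × EY => S.fX p.1 := S.measurable_fX.comp measurable_fst
  set F : EX × EY → ℝ := {p | S.fX p.1 ∈ G ∧ (T (S.fX p.1)).Nonempty}.indicator
    fun p => h (S.fX p.1) with hF
  have hFm : Measurable F := (hm.comp hX).indicator
    ((hX hG).inter (hX hT.measurableSet_nonempty))
  have hFcond (ε : ED × EX × EY) : F ε.2
      = if S.X ε ∈ G ∧ (T (S.X ε)).Nonempty then S.condMean T ε else 0 := by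
    rw [hh, hF, Set.indicator_apply]; rfl
  have hFint : Integrable (fun ε : ED × EX × EY => F ε.2) S.law := by
    refine Integrable.of_bound (hFm.comp measurable_snd).aestronglyMeasurable |C| ?_
    filter_upwards [S.ae_abs_condMean_le hpos hT hC] with ε hε
    rw [hFcond]
    split_ifs with hcase
    · exact (hε hcase.2).trans (le_abs_self C)
    · simp
  -- Now the integrand is a function of `X`, and the weight can be integrated out.
  have hkey := S.integral_mul_ipw hpos hT hFint
  simp only [hFcond] at hkey
  calc _ = ∫ ε, (if (T (S.X ε)).Nonempty then
        (if S.X ε ∈ G ∧ (T (S.X ε)).Nonempty then S.condMean T ε else 0) else 0) ∂S.law := by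
        congr 1; ext ε; split_ifs <;> simp_all
    _ = _ := by
        rw [← hkey]; congr 1; ext ε; split_ifs <;> simp

end TrialSCM

end Trial

/-! ### Transfer of the limit theorems to copies of a statistic. -/

section Sample

/-- Large-sample theory of the mean of i.i.d. copies `X i` of a square-integrable `ψ`. -/
theorem asymptotics_of_identDistrib {Ω Ω' : Type*} [MeasurableSpace Ω] [MeasurableSpace Ω']
    {P : Measure Ω} [IsProbabilityMeasure P] {Q : Measure Ω'} {X : ℕ → Ω → ℝ} {ψ : Ω' → ℝ}
    (hψ : MemLp ψ 2 Q) (hindep : iIndepFun X P) (hident : ∀ i, IdentDistrib (X i) ψ P Q) :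
    TendstoInDistribution (fun (n : ℕ) ω => √(n : ℝ) * (Q[ψ] - empMean (fun i => X i ω) n)) atTop
      id (fun _ => P) (gaussianReal 0 Var[ψ; Q].toNNReal) ∧
    ∀ α ∈ Set.Ioo (0 : ℝ) 1,
      limsup (fun n : ℕ => P {ω | Q[ψ] < ciLower α (fun i => X i ω) n}) atTop
        ≤ ENNReal.ofReal (α / 2) ∧
      limsup (fun n : ℕ => P {ω | ciUpper α (fun i => X i ω) n < Q[ψ]}) atTop
        ≤ ENNReal.ofReal (α / 2) := by
  have hX := (hident 0).memLp_iff.2 hψ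
  have hident' (i) : IdentDistrib (X i) (X 0) P P := (hident i).trans (hident 0).symm
  rw [← (hident 0).integral_eq, ← (hident 0).variance_eq]
  exact ⟨tendstoInDistribution_sqrt_mul_sub_empMean hX hindep hident', fun α hα =>
    ⟨limsup_measure_lt_ciLower_le hX hindep hident' hα,
      limsup_measure_ciUpper_lt_le hX hindep hident' hα⟩⟩

end Sample

/-! ### The bounds as weighted means, and their comparison with the policy value. -/

section Bounds

namespace TrialSCM

variable {ED EX EY 𝒟 𝒳 𝒜 : Type*} [MeasurableSpace ED] [MeasurableSpace EX]
  [MeasurableSpace EY] [MeasurableSpace 𝒟] [MeasurableSpace 𝒳] [MeasurableSpace 𝒜]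
  (S : TrialSCM ED EX EY 𝒟 𝒳 𝒜)

open Classical in
/-- The inverse-probability weighted outcome for the selection `T`, equal to `c` where `T` is
empty. -/
noncomputable def weighted (T : 𝒳 → Set (𝒳 → 𝒜)) (c y : ℝ) (x : 𝒳) (π : 𝒳 → 𝒜) : ℝ :=
  if (T x).Nonempty then y * S.ipw (T x) π else c

open Classical in
/-- The selection `T` where `πe` does not take the neutral action, and `S.agree πe` elsewhere. -/
noncomputable def orAgree (a₀ : 𝒜) (πe : 𝒳 → 𝒜) (T : 𝒳 → Set (𝒳 → 𝒜)) (x : 𝒳) :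
    Set (𝒳 → 𝒜) :=
  if πe x ≠ a₀ then T x else S.agree πe x

lemma psiL_eq_weighted (a₀ : 𝒜) (ymin : ℝ) (πe : 𝒳 → 𝒜) (y : ℝ) (x : 𝒳) (π : 𝒳 → 𝒜) :
    S.psiL a₀ ymin πe y x π = S.weighted (S.orAgree a₀ πe (S.nextWorst πe)) ymin y x π := by
  by_cases h : πe x = a₀
  · have hT : S.orAgree a₀ πe (S.nextWorst πe) x = S.agree πe x := by simp [orAgree, h]
    unfold psiL weighted
    rw [hT]
    simp [h]
  · have hT : S.orAgree a₀ πe (S.nextWorst πe) x = S.nextWorst πe x := by simp [orAgree, h]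
    unfold psiL weighted
    rw [hT]
    simp [h]

lemma psiU_eq_weighted (a₀ : 𝒜) (ymax : ℝ) (πe : 𝒳 → 𝒜) (y : ℝ) (x : 𝒳) (π : 𝒳 → 𝒜) :
    S.psiU a₀ ymax πe y x π = S.weighted (S.orAgree a₀ πe (S.nextBest πe)) ymax y x π := by
  by_cases h : πe x = a₀
  · have hT : S.orAgree a₀ πe (S.nextBest πe) x = S.agree πe x := by simp [orAgree, h]
    unfold psiU weighted
    rw [hT]
    simp [h]
  · have hT : S.orAgree a₀ πe (S.nextBest πe) x = S.nextBest πe x := by simp [orAgree, h]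
    unfold psiU weighted
    rw [hT]
    simp [h]

variable {S}

lemma measurableSet_ne_action [MeasurableEq 𝒜] {πe : 𝒳 → 𝒜} (hπe : Measurable πe) (a₀ : 𝒜) :
    MeasurableSet {x | πe x ≠ a₀} :=
  (measurableSet_eq_fun hπe measurable_const).compl

lemma IsSelection.orAgree [MeasurableEq 𝒜] {πe : 𝒳 → 𝒜} (hπe : Measurable πe) (a₀ : 𝒜)
    {T : 𝒳 → Set (𝒳 → 𝒜)} (hT : S.IsSelection T) : S.IsSelection (S.orAgree a₀ πe T) where
  subset x := by
    unfold TrialSCM.orAgree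
    split_ifs
    exacts [hT.subset x, (S.isSelection_agree hπe).subset x]
  measurableSet_mem π hπ := by
    convert (measurableSet_ne_action hπe a₀).ite (hT.measurableSet_mem π hπ)
      ((S.isSelection_agree hπe).measurableSet_mem π hπ) using 1
    ext x
    by_cases hx : πe x = a₀ <;> simp [Set.ite, TrialSCM.orAgree, hx]

lemma IsSelection.measurable_weighted {T : 𝒳 → Set (𝒳 → 𝒜)} (hT : S.IsSelection T) (c : ℝ) :
    Measurable fun p : ℝ × 𝒳 × 𝒟 => S.weighted T c p.1 p.2.1 (S.pol p.2.2) := by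
  refine Measurable.ite ?_ ?_ measurable_const
  · exact (measurable_fst.comp measurable_snd) hT.measurableSet_nonempty
  · exact measurable_fst.mul ((hT.measurable_comp_pol S.ipw).comp measurable_snd)

variable (S)

lemma memLp_weighted {T : 𝒳 → Set (𝒳 → 𝒜)} (hT : S.IsSelection T) {C : ℝ}
    (hC : ∀ᵐ ε ∂S.law, |S.Y ε| ≤ C) (hYm : AEMeasurable S.Y S.law) (c : ℝ) :
    MemLp (fun ε => S.weighted T c (S.Y ε) (S.X ε) (S.Pi ε)) 2 S.law := by
  obtain ⟨K, hK⟩ := hT.exists_abs_ipw_le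
  have hm : AEMeasurable (fun ε => S.weighted T c (S.Y ε) (S.X ε) (S.Pi ε)) S.law :=
    (hT.measurable_weighted c).comp_aemeasurable
      (hYm.prodMk (S.measurable_X.prodMk S.measurable_D).aemeasurable)
  refine MemLp.of_bound hm.aestronglyMeasurable (max (C * K) |c|) ?_
  filter_upwards [hC] with ε hε
  unfold weighted
  split_ifs
  · rw [norm_mul]
    exact le_max_of_le_left (mul_le_mul hε (hK _ _) (norm_nonneg _) ((abs_nonneg _).trans hε))
  · exact le_max_right _ _

open Classical in
-- The two conditional means are taken under different conditional laws, so they are not the mean of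
-- one merged selection. The integral is split over the `X`-events `G` and `G'`, with the default
-- value `c` in a separate term common to both sides.
theorem integrable_and_integral_piecewise_condMean [MeasurableEq 𝒜]
    (hpos : ∀ π ∈ S.trialed, 0 < S.law {ε | S.Pi ε = π})
    {T : 𝒳 → Set (𝒳 → 𝒜)} (h₁ : S.IsSelection T) {C : ℝ}
    (hC : ∀ᵐ ε ∂S.law, |S.Y ε| ≤ C) (hYm : AEMeasurable S.Y S.law)
    {πe : 𝒳 → 𝒜} (hπe : Measurable πe) (a₀ : 𝒜) (c : ℝ) :
    Integrable (fun ε => if πe (S.X ε) ≠ a₀ then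
      if (T (S.X ε)).Nonempty then S.condMean T ε else c
      else if (S.agree πe (S.X ε)).Nonempty then S.condMean (S.agree πe) ε else c) S.law ∧
    ∫ ε, (if πe (S.X ε) ≠ a₀ then
      if (T (S.X ε)).Nonempty then S.condMean T ε else c
      else if (S.agree πe (S.X ε)).Nonempty then S.condMean (S.agree πe) ε else c) ∂S.law
      = ∫ ε, S.weighted (S.orAgree a₀ πe T) c (S.Y ε) (S.X ε) (S.Pi ε) ∂S.law := by
  have h₂ := S.isSelection_agree hπe
  obtain ⟨G, hGdef⟩ : ∃ G, G = {x | πe x ≠ a₀} := ⟨_, rfl⟩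
  have hG : MeasurableSet G := hGdef ▸ measurableSet_ne_action hπe a₀
  obtain ⟨G', hG'def⟩ : ∃ G', G' = {x | πe x = a₀} := ⟨_, rfl⟩
  have hG' : MeasurableSet G' := hG'def ▸ measurableSet_eq_fun hπe measurable_const
  have hset {T : 𝒳 → Set (𝒳 → 𝒜)} (hT : S.IsSelection T) {G : Set 𝒳} (hG : MeasurableSet G) :
      MeasurableSet {ε | S.X ε ∈ G ∧ (T (S.X ε)).Nonempty} :=
    S.measurable_X (hG.inter hT.measurableSet_nonempty)
  have hA {T : 𝒳 → Set (𝒳 → 𝒜)} (hT : S.IsSelection T) {G : Set 𝒳} (hG : MeasurableSet G) :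
      Integrable (fun ε => if S.X ε ∈ G ∧ (T (S.X ε)).Nonempty then S.condMean T ε else 0)
        S.law := by
    have hm : Measurable (S.condMean T) := (S.measurable_condMean T).mono S.measurable_X.comap_le
      le_rfl
    refine Integrable.of_bound (Measurable.ite (hset hT hG) hm
      measurable_const).aestronglyMeasurable |C| ?_
    filter_upwards [S.ae_abs_condMean_le hpos hT hC] with ε hε
    split_ifs with h
    · exact (hε h.2).trans (le_abs_self C)
    · simp
  have hB {T : 𝒳 → Set (𝒳 → 𝒜)} (hT : S.IsSelection T) {G : Set 𝒳} (hG : MeasurableSet G) :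
      Integrable (fun ε => if S.X ε ∈ G ∧ (T (S.X ε)).Nonempty then
        S.Y ε * S.ipw (T (S.X ε)) (S.Pi ε) else 0) S.law := by
    refine (((S.memLp_weighted hT hC hYm 0).integrable (by norm_num)).indicator
      (S.measurable_X hG)).congr (ae_of_all _ fun ε => ?_)
    by_cases hx : S.X ε ∈ G <;> simp [weighted, Set.indicator, hx]
  have hR : Integrable (fun ε => if (S.orAgree a₀ πe T (S.X ε)).Nonempty then 0 else c) S.law :=
    Integrable.of_bound (Measurable.ite
      (S.measurable_X (h₁.orAgree hπe a₀).measurableSet_nonempty) measurable_const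
        measurable_const).aestronglyMeasurable |c|
      (ae_of_all _ fun ε => by split_ifs <;> simp)
  have hf : (fun ε => if πe (S.X ε) ≠ a₀ then
      if (T (S.X ε)).Nonempty then S.condMean T ε else c
      else if (S.agree πe (S.X ε)).Nonempty then S.condMean (S.agree πe) ε else c)
      = fun ε => ((if S.X ε ∈ G ∧ (T (S.X ε)).Nonempty then S.condMean T ε else 0)
        + (if S.X ε ∈ G' ∧ (S.agree πe (S.X ε)).Nonempty then S.condMean (S.agree πe) ε else 0))
        + (if (S.orAgree a₀ πe T (S.X ε)).Nonempty then 0 else c) := by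
    ext ε
    by_cases hx : πe (S.X ε) = a₀
    · have hx' : S.X ε ∉ G := by simp [hGdef, hx]
      have hx'' : S.X ε ∈ G' := by simp [hG'def, hx]
      by_cases hne : (S.agree πe (S.X ε)).Nonempty <;> simp [orAgree, hx, hx', hx'', hne]
    · have hx' : S.X ε ∈ G := by simp [hGdef, hx]
      have hx'' : S.X ε ∉ G' := by simp [hG'def, hx]
      by_cases hne : (T (S.X ε)).Nonempty <;> simp [orAgree, hx, hx', hx'', hne]
  have hψ : (fun ε => S.weighted (S.orAgree a₀ πe T) c (S.Y ε) (S.X ε) (S.Pi ε))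
      = fun ε => ((if S.X ε ∈ G ∧ (T (S.X ε)).Nonempty then
          S.Y ε * S.ipw (T (S.X ε)) (S.Pi ε) else 0)
        + (if S.X ε ∈ G' ∧ (S.agree πe (S.X ε)).Nonempty then
          S.Y ε * S.ipw (S.agree πe (S.X ε)) (S.Pi ε) else 0))
        + (if (S.orAgree a₀ πe T (S.X ε)).Nonempty then 0 else c) := by
    ext ε
    by_cases hx : πe (S.X ε) = a₀
    · have hx' : S.X ε ∉ G := by simp [hGdef, hx]
      have hx'' : S.X ε ∈ G' := by simp [hG'def, hx]
      by_cases hne : (S.agree πe (S.X ε)).Nonempty <;> simp [weighted, orAgree, hx, hx', hx'', hne]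
    · have hx' : S.X ε ∈ G := by simp [hGdef, hx]
      have hx'' : S.X ε ∉ G' := by simp [hG'def, hx]
      by_cases hne : (T (S.X ε)).Nonempty <;> simp [weighted, orAgree, hx, hx', hx'', hne]
  have hA₂ : Integrable (fun ε => (if S.X ε ∈ G ∧ (T (S.X ε)).Nonempty then S.condMean T ε else 0)
        + (if S.X ε ∈ G' ∧ (S.agree πe (S.X ε)).Nonempty then S.condMean (S.agree πe) ε else 0))
        S.law := (hA h₁ hG).add (hA h₂ hG')
  have hB₂ : Integrable (fun ε => (if S.X ε ∈ G ∧ (T (S.X ε)).Nonempty then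
          S.Y ε * S.ipw (T (S.X ε)) (S.Pi ε) else 0)
        + (if S.X ε ∈ G' ∧ (S.agree πe (S.X ε)).Nonempty then
          S.Y ε * S.ipw (S.agree πe (S.X ε)) (S.Pi ε) else 0)) S.law :=
    (hB h₁ hG).add (hB h₂ hG')
  rw [hf, hψ]
  refine ⟨hA₂.add hR, ?_⟩
  rw [integral_add hA₂ hR, integral_add (hA h₁ hG) (hA h₂ hG'),
    integral_add hB₂ hR, integral_add (hB h₁ hG) (hB h₂ hG'),
    S.integral_condMean_eq hpos h₁ hC hYm hG, S.integral_condMean_eq hpos h₂ hC hYm hG']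

open Classical in
-- Taking `F` itself as the default value covers the points where `T` is empty; elsewhere the
-- weights have mean one over `εD`.
lemma integrable_and_integral_weighted_self
    (hpos : ∀ π ∈ S.trialed, 0 < S.law {ε | S.Pi ε = π})
    {T : 𝒳 → Set (𝒳 → 𝒜)} (hT : S.IsSelection T) {F : EX × EY → ℝ}
    (hF : Integrable (fun ε : ED × EX × EY => F ε.2) S.law) :
    Integrable (fun ε => S.weighted T (F ε.2) (F ε.2) (S.X ε) (S.Pi ε)) S.law ∧
    ∫ ε, S.weighted T (F ε.2) (F ε.2) (S.X ε) (S.Pi ε) ∂S.law = ∫ ε, F ε.2 ∂S.law := by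
  obtain ⟨K, hK⟩ := hT.exists_abs_ipw_le
  have hne : MeasurableSet {ε | (T (S.X ε)).Nonempty} := S.measurable_X hT.measurableSet_nonempty
  have h1 : Integrable (fun ε => F ε.2 * S.ipw (T (S.X ε)) (S.Pi ε)) S.law :=
    hF.mul_bdd (c := K) (hT.measurable_comp_Pi S.ipw).aestronglyMeasurable
      (ae_of_all _ fun ε => hK _ _)
  have h2 : Integrable (fun ε => if (T (S.X ε)).Nonempty then 0 else F ε.2) S.law := by
    refine (hF.indicator hne.compl).congr (ae_of_all _ fun ε => ?_)
    by_cases h : (T (S.X ε)).Nonempty <;> simp [Set.indicator, h]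
  have h3 : Integrable (fun ε => if (T (S.X ε)).Nonempty then F ε.2 else 0) S.law := by
    refine (hF.indicator hne).congr (ae_of_all _ fun ε => ?_)
    by_cases h : (T (S.X ε)).Nonempty <;> simp [Set.indicator, h]
  have heq : (fun ε => S.weighted T (F ε.2) (F ε.2) (S.X ε) (S.Pi ε))
      = fun ε => F ε.2 * S.ipw (T (S.X ε)) (S.Pi ε)
        + if (T (S.X ε)).Nonempty then 0 else F ε.2 := by
    ext ε
    unfold weighted
    split_ifs with h
    · simp
    · rw [Set.not_nonempty_iff_eq_empty] at h
      simp [h, ipw]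
  rw [heq]
  refine ⟨h1.add h2, ?_⟩
  rw [integral_add h1 h2, S.integral_mul_ipw hpos hT hF, ← integral_add h3 h2]
  congr 1
  ext ε
  split_ifs <;> simp

/-- Outcomes need comparing only on selected arms, since the weight vanishes off them. -/
lemma weighted_mono {T : 𝒳 → Set (𝒳 → 𝒜)} {c c' y y' : ℝ} {x : 𝒳} {π : 𝒳 → 𝒜} (hc : c ≤ c')
    (hy : π ∈ T x → y ≤ y') : S.weighted T c y x π ≤ S.weighted T c' y' x π := by
  unfold weighted
  split_ifs
  · by_cases h : π ∈ T x
    · exact mul_le_mul_of_nonneg_right (hy h) (S.ipw_nonneg _ _)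
    · simp [S.ipw_of_notMem h]
  · exact hc

/-- The inverse-probability weighted means bound the policy value, if the selected policies have
outcomes below (respectively above) those of `πe`. -/
theorem integral_weighted_le_policyValue_le
    (hpos : ∀ π ∈ S.trialed, 0 < S.law {ε | S.Pi ε = π})
    {T T' : 𝒳 → Set (𝒳 → 𝒜)} (hT : S.IsSelection T) (hT' : S.IsSelection T') {C : ℝ}
    (hC : ∀ᵐ ε ∂S.law, |S.Y ε| ≤ C) (hYm : AEMeasurable S.Y S.law)
    {πe : 𝒳 → 𝒜} (hπe : Measurable πe) {ymin ymax : ℝ} (hbdd : S.PotentialBounded ymin ymax)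
    (hle : ∀ᵐ ε ∂S.law, S.Pi ε ∈ T (S.X ε) →
      S.Y ε ≤ S.potential (πe (S.X ε)) (S.fM πe) ε)
    (hge : ∀ᵐ ε ∂S.law, S.Pi ε ∈ T' (S.X ε) →
      S.potential (πe (S.X ε)) (S.fM πe) ε ≤ S.Y ε) :
    ∫ ε, S.weighted T ymin (S.Y ε) (S.X ε) (S.Pi ε) ∂S.law ≤ S.policyValue πe ∧
    S.policyValue πe ≤ ∫ ε, S.weighted T' ymax (S.Y ε) (S.X ε) (S.Pi ε) ∂S.law := by
  -- The potential outcome under `πe` does not involve `εD`, so weighting preserves its mean.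
  set F : EX × EY → ℝ := fun p => S.fY (πe (S.fX p.1)) (S.fX p.1) (S.fM πe) p.2 with hFdef
  have hX : Measurable fun p : EX × EY => S.fX p.1 := S.measurable_fX.comp measurable_fst
  have hFm : Measurable F := S.measurable_fY.comp
    ((hπe.comp hX).prodMk (hX.prodMk (measurable_const.prodMk measurable_snd)))
  have hFV (ε : ED × EX × EY) : F ε.2 = S.potential (πe (S.X ε)) (S.fM πe) ε := rfl
  have hF : Integrable (fun ε : ED × EX × EY => F ε.2) S.law := by
    refine Integrable.of_bound (hFm.comp measurable_snd).aestronglyMeasurable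
      (max |ymin| |ymax|) ?_
    filter_upwards [hbdd] with ε hε
    exact abs_le_max_abs_abs (hε _ _).1 (hε _ _).2
  have hval : S.policyValue πe = ∫ ε, F ε.2 ∂S.law := rfl
  obtain ⟨hi, he⟩ := S.integrable_and_integral_weighted_self hpos hT hF
  obtain ⟨hi', he'⟩ := S.integrable_and_integral_weighted_self hpos hT' hF
  constructor
  · rw [hval, ← he]
    refine integral_mono_ae ((S.memLp_weighted hT hC hYm _).integrable (by norm_num)) hi ?_
    filter_upwards [hbdd, hle] with ε hε hε'
    exact S.weighted_mono (hε _ _).1 hε'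
  · rw [hval, ← he']
    refine integral_mono_ae hi' ((S.memLp_weighted hT' hC hYm _).integrable (by norm_num)) ?_
    filter_upwards [hbdd, hge] with ε hε hε'
    exact S.weighted_mono (hε _ _).2 hε'

lemma Y_eq_potential {πe : 𝒳 → 𝒜} {ε : ED × EX × EY} (h : S.Pi ε (S.X ε) = πe (S.X ε)) :
    S.Y ε = S.potential (πe (S.X ε)) (S.fM (S.Pi ε)) ε := by
  unfold Y A M potential
  rw [h]

lemma PerformanceMonotone.monotone {S : TrialSCM ED EX EY 𝒟 𝒳 𝒜} (h : S.PerformanceMonotone) :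
    ∀ᵐ ε ∂S.law, ∀ (a : 𝒜) (m m' : ℝ), m ≤ m' → S.potential a m ε ≤ S.potential a m' ε := by
  filter_upwards [h] with ε hε a m m' hm
  rcases hm.eq_or_lt with rfl | hlt
  · exact le_rfl
  · exact hε a m m' hlt

/-- Where `πe` plays `a₀`, agreeing arms of any performance give the same outcome by neutrality;
elsewhere the selected arm performs no better than `πe`. -/
lemma ae_Y_le_potential_of_mem_nextWorst {a₀ : 𝒜} (hmono : S.PerformanceMonotone)
    (hneut : S.NeutralAction a₀) (πe : 𝒳 → 𝒜) :
    ∀ᵐ ε ∂S.law, S.Pi ε ∈ S.orAgree a₀ πe (S.nextWorst πe) (S.X ε) →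
      S.Y ε ≤ S.potential (πe (S.X ε)) (S.fM πe) ε := by
  filter_upwards [hmono.monotone, hneut] with ε hm hn hmem
  by_cases h : πe (S.X ε) = a₀
  · simp only [orAgree, h, ne_eq, not_true_eq_false, if_false] at hmem
    rw [S.Y_eq_potential hmem.2, h]
    exact (hn _ _).le
  · simp only [orAgree, h, ne_eq, not_false_eq_true, if_true] at hmem
    rw [S.Y_eq_potential hmem.1.2.1]
    exact hm _ _ _ hmem.1.2.2

lemma ae_potential_le_Y_of_mem_nextBest {a₀ : 𝒜} (hmono : S.PerformanceMonotone)
    (hneut : S.NeutralAction a₀) (πe : 𝒳 → 𝒜) :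
    ∀ᵐ ε ∂S.law, S.Pi ε ∈ S.orAgree a₀ πe (S.nextBest πe) (S.X ε) →
      S.potential (πe (S.X ε)) (S.fM πe) ε ≤ S.Y ε := by
  filter_upwards [hmono.monotone, hneut] with ε hm hn hmem
  by_cases h : πe (S.X ε) = a₀
  · simp only [orAgree, h, ne_eq, not_true_eq_false, if_false] at hmem
    rw [S.Y_eq_potential hmem.2, h]
    exact (hn _ _).le
  · simp only [orAgree, h, ne_eq, not_false_eq_true, if_true] at hmem
    rw [S.Y_eq_potential hmem.1.2.1]
    exact hm _ _ _ hmem.1.2.2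

end TrialSCM

end Bounds

/-! ### The main theorem. -/

theorem proposition4
    {ED EX EY 𝒟 𝒳 𝒜 : Type*} [MeasurableSpace ED] [MeasurableSpace EX] [MeasurableSpace EY]
    [MeasurableSpace 𝒟] [MeasurableSpace 𝒳] [MeasurableSpace 𝒜] [MeasurableEq 𝒜]
    (S : TrialSCM ED EX EY 𝒟 𝒳 𝒜)
    -- every trialed policy is assigned with positive probability
    (hpos : ∀ π ∈ S.trialed, 0 < S.law {ε | S.Pi ε = π})
    -- the observed outcome is bounded
    (ymin ymax : ℝ) (hY : ∀ᵐ ε ∂S.law, S.Y ε ∈ Set.Icc ymin ymax)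
    -- the neutral action and the new policy
    (a₀ : 𝒜) (πe : 𝒳 → 𝒜) (hπe : Measurable πe)
    -- the trial data: i.i.d. draws of `(Y, X, D)`; the policy of unit `i` is `S.pol (Ds i ω)`
    {Ω : Type*} [MeasurableSpace Ω] (P : Measure Ω) [IsProbabilityMeasure P]
    (Ys : ℕ → Ω → ℝ) (Xs : ℕ → Ω → 𝒳) (Ds : ℕ → Ω → 𝒟)
    (hindep : iIndepFun (fun i ω => (Ys i ω, Xs i ω, Ds i ω)) P)
    (hlaw : ∀ i, IdentDistrib (fun ω => (Ys i ω, Xs i ω, Ds i ω))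
      (fun ε => (S.Y ε, S.X ε, S.D ε)) P S.law)
    -- the functions of the data that are averaged
    (ψL ψU : ED × EX × EY → ℝ)
    (hψL : ψL = fun ε => S.psiL a₀ ymin πe (S.Y ε) (S.X ε) (S.Pi ε))
    (hψU : ψU = fun ε => S.psiU a₀ ymax πe (S.Y ε) (S.X ε) (S.Pi ε))
    (vL vU : Ω → ℕ → ℝ)
    (hvL : vL = fun ω i => S.psiL a₀ ymin πe (Ys i ω) (Xs i ω) (S.pol (Ds i ω)))
    (hvU : vU = fun ω i => S.psiU a₀ ymax πe (Ys i ω) (Xs i ω) (S.pol (Ds i ω))) :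
    -- the bounds as expectations, all of which exist
    (Integrable (S.lowerIntegrand a₀ ymin πe) S.law ∧ MemLp ψL 2 S.law ∧
      S.lowerBound a₀ ymin πe = ∫ ε, ψL ε ∂S.law) ∧
    (Integrable (S.upperIntegrand a₀ ymax πe) S.law ∧ MemLp ψU 2 S.law ∧
      S.upperBound a₀ ymax πe = ∫ ε, ψU ε ∂S.law) ∧
    -- asymptotic normality of both empirical means
    TendstoInDistribution
      (fun (n : ℕ) ω => √(n : ℝ) * (S.lowerBound a₀ ymin πe - empMean (vL ω) n)) atTop
      id (fun _ => P) (gaussianReal 0 (variance ψL S.law).toNNReal) ∧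
    TendstoInDistribution
      (fun (n : ℕ) ω => √(n : ℝ) * (S.upperBound a₀ ymax πe - empMean (vU ω) n)) atTop
      id (fun _ => P) (gaussianReal 0 (variance ψU S.law).toNNReal) ∧
    -- asymptotic validity of the confidence interval, for the pair of bounds
    (∀ α ∈ Set.Ioo (0 : ℝ) 1,
      ENNReal.ofReal (1 - α) ≤ liminf (fun n : ℕ =>
        P {ω | ciLower α (vL ω) n ≤ S.lowerBound a₀ ymin πe ∧
          S.upperBound a₀ ymax πe ≤ ciUpper α (vU ω) n}) atTop) ∧
    -- and, under the assumptions that make them bounds, for the policy value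
    (S.PerformanceMonotone → S.NeutralAction a₀ → S.PotentialBounded ymin ymax →
      ∀ α ∈ Set.Ioo (0 : ℝ) 1,
        ENNReal.ofReal (1 - α) ≤ liminf (fun n : ℕ =>
          P {ω | S.policyValue πe ∈ Set.Icc (ciLower α (vL ω) n) (ciUpper α (vU ω) n)}) atTop) := by
  -- Measurability of `Y` is part of the identical distribution of the data.
  have hYXD : AEMeasurable (fun ε => (S.Y ε, S.X ε, S.D ε)) S.law := (hlaw 0).aemeasurable_snd
  have hYm : AEMeasurable S.Y S.law := measurable_fst.comp_aemeasurable hYXD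
  have hC : ∀ᵐ ε ∂S.law, |S.Y ε| ≤ max |ymin| |ymax| := by
    filter_upwards [hY] with ε hε
    exact abs_le_max_abs_abs hε.1 hε.2
  have hW := S.isSelection_nextWorst hπe
  have hB := S.isSelection_nextBest hπe
  have hTL := hW.orAgree hπe a₀
  have hTU := hB.orAgree hπe a₀
  simp only [S.psiL_eq_weighted] at hψL hvL
  simp only [S.psiU_eq_weighted] at hψU hvU
  have memL : MemLp ψL 2 S.law := hψL ▸ S.memLp_weighted hTL hC hYm ymin
  have memU : MemLp ψU 2 S.law := hψU ▸ S.memLp_weighted hTU hC hYm ymax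
  obtain ⟨intL, eqL⟩ := S.integrable_and_integral_piecewise_condMean hpos hW hC hYm hπe a₀ ymin
  obtain ⟨intU, eqU⟩ := S.integrable_and_integral_piecewise_condMean hpos hB hC hYm hπe a₀ ymax
  have hL : S.lowerBound a₀ ymin πe = ∫ ε, ψL ε ∂S.law := by
    rw [hψL]
    exact eqL
  have hU : S.upperBound a₀ ymax πe = ∫ ε, ψU ε ∂S.law := by
    rw [hψU]
    exact eqU
  obtain ⟨cltL, ciL⟩ := asymptotics_of_identDistrib memL
    (X := fun i ω => vL ω i)
    (by subst hvL; exact hindep.comp _ fun _ => hTL.measurable_weighted ymin)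
    (by subst hvL hψL; exact fun i => (hlaw i).comp (hTL.measurable_weighted ymin))
  obtain ⟨cltU, ciU⟩ := asymptotics_of_identDistrib memU
    (X := fun i ω => vU ω i)
    (by subst hvU; exact hindep.comp _ fun _ => hTU.measurable_weighted ymax)
    (by subst hvU hψU; exact fun i => (hlaw i).comp (hTU.measurable_weighted ymax))
  rw [← hL] at cltL
  rw [← hU] at cltU
  simp only [← hL] at ciL
  simp only [← hU] at ciU
  have cover : ∀ α ∈ Set.Ioo (0 : ℝ) 1,
      ENNReal.ofReal (1 - α) ≤ liminf (fun n : ℕ =>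
        P {ω | ciLower α (vL ω) n ≤ S.lowerBound a₀ ymin πe ∧
          S.upperBound a₀ ymax πe ≤ ciUpper α (vU ω) n}) atTop := by
    intro α hα
    have hα2 : 0 ≤ α / 2 := by linarith [hα.1]
    have := ofReal_one_sub_le_liminf_measure hα2 hα2 (ciL α hα).1 (ciU α hα).2
      (C := fun n => {ω | ciLower α (vL ω) n ≤ S.lowerBound a₀ ymin πe ∧
          S.upperBound a₀ ymax πe ≤ ciUpper α (vU ω) n})
      (fun n ω hω => by
        simp only [Set.mem_compl_iff, Set.mem_union, Set.mem_ofPred_eq, not_or, not_lt] at hω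
        exact hω)
    rwa [add_halves] at this
  refine ⟨⟨intL, memL, hL⟩, ⟨intU, memU, hU⟩, cltL, cltU, cover,
    fun hmono hneut hbdd α hα => ?_⟩
  obtain ⟨hle, hge⟩ := S.integral_weighted_le_policyValue_le hpos hTL hTU hC hYm hπe hbdd
    (S.ae_Y_le_potential_of_mem_nextWorst hmono hneut πe)
    (S.ae_potential_le_Y_of_mem_nextBest hmono hneut πe)
  rw [hψL] at hL
  rw [hψU] at hU
  rw [← hL] at hle
  rw [← hU] at hge
  -- The policy value lies between `L` and `U`, so it is covered whenever both bounds are.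
  refine (cover α hα).trans (liminf_le_liminf (Eventually.of_forall fun n => measure_mono ?_))
  exact fun ω hω => ⟨hω.1.trans hle, hge.trans hω.2⟩
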